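/- Let $D$ be a set of cardinality $\aleph_1$, and let $L=D\cup\{x_0\}$, with $x_0\notin D$, be the one-point Lindelöfication of the discrete space $D$: every point of $D$ is isolated in $L$, and the sets $L\setminus C$, with $C$ a countable subset of $D$, form a local base at $x_0$. Let $H$ be the free abelian topological group over $L$, i.e. the free abelian group on the set $L$ with the finest group topology for which the canonical map $L\to H$ is continuous. Call an abelian topological group prodiscrete if it is Hausdorff, complete, and has a local base at the identity consisting of open subgroups, and call a topological group pro-Lie if it is topologically isomorphic to a projective limit, over a directed set, of finite-dimensional real Lie groups. Then there exist a separable abelian topological group $G$ that is both prodiscrete and pro-Lie, and a closed subgroup $K$ of $G$, such that $K$ is topologically isomorphic to $H$ and $K$ is not separable. In particular, closed subgroups of separable prodiscrete abelian groups, and closed subgroups of separable pro-Lie groups, need not be separable. -/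

import Mathlib

open scoped Manifold ContDiff

universe u

/-- The one-point Lindelöfication `D ∪ {x₀}` of the discrete set `D`; `infty` is the point `x₀`. -/
inductive OnePointLindelofication (D : Type u) : Type u
  | pt (d : D)
  | infty

/-- Every point of `D` is isolated, and the sets `L \ C`, `C` a countable subset of `D`, form a
local base at the added point. -/
instance (D : Type u) : TopologicalSpace (OnePointLindelofication D) where
  IsOpen U := .infty ∈ U → {d : D | .pt d ∉ U}.Countable
  isOpen_univ := by
    intro _
    simp
  isOpen_inter := by
    intro s t hs ht h
    refine ((hs h.1).union (ht h.2)).mono ?_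
    intro d hd
    by_cases h1 : .pt d ∈ s
    · exact Or.inr fun h2 => hd ⟨h1, h2⟩
    · exact Or.inl h1
  isOpen_sUnion := by
    intro S hS h
    obtain ⟨t, ht, hmem⟩ := h
    exact (hS t ht hmem).mono fun d hd hdt => hd ⟨t, ht, hdt⟩

/-- The underlying group of the free abelian topological group over `X`. -/
def FreeAbelianTopGroup (X : Type u) : Type u := FreeAbelianGroup X

noncomputable instance (X : Type u) : AddCommGroup (FreeAbelianTopGroup X) :=
  inferInstanceAs (AddCommGroup (FreeAbelianGroup X))

/-- The canonical map from `X` to the free abelian topological group over `X`. -/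
def FreeAbelianTopGroup.of {X : Type u} (x : X) : FreeAbelianTopGroup X :=
  FreeAbelianGroup.of x

/-- The topology of the free abelian topological group: the finest group topology for which the
canonical map from `X` is continuous. -/
noncomputable instance (X : Type u) [TopologicalSpace X] : TopologicalSpace (FreeAbelianTopGroup X) :=
  (AddGroupTopology.coinduced
    (FreeAbelianTopGroup.of : X → FreeAbelianTopGroup X)).toTopologicalSpace

instance (X : Type u) [TopologicalSpace X] : IsTopologicalAddGroup (FreeAbelianTopGroup X) :=
  (AddGroupTopology.coinduced
    (FreeAbelianTopGroup.of : X → FreeAbelianTopGroup X)).toIsTopologicalAddGroup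

/-- An abelian topological group is prodiscrete if it is Hausdorff, the open subgroups form a local
base at the identity, and it is complete in its group uniformity. -/
structure IsProdiscrete (G : Type u) [AddCommGroup G] [TopologicalSpace G]
    [IsTopologicalAddGroup G] : Prop where
  t2 : T2Space G
  nonarchimedean : NonarchimedeanAddGroup G
  complete : @CompleteSpace G (IsTopologicalAddGroup.rightUniformSpace G)

/-- A (not necessarily commutative, additively written) topological group is a finite-dimensional
real Lie group. -/
def IsFiniteDimLieGroup (A : Type u) [AddGroup A] [TopologicalSpace A] : Prop :=
  T2Space A ∧ ∃ (n : ℕ) (_ : ChartedSpace (EuclideanSpace ℝ (Fin n)) A), LieAddGroup (𝓡 n) ∞ A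

/-- A projective system of topological groups over a directed set `J`. -/
structure ProjectiveSystem (J : Type u) [Preorder J] where
  obj : J → Type u
  [addGroup : ∀ j, AddGroup (obj j)]
  [topology : ∀ j, TopologicalSpace (obj j)]
  map : ∀ {i j : J}, i ≤ j → obj j →+ obj i
  continuous_map : ∀ {i j : J} (h : i ≤ j), Continuous (map h)
  map_refl : ∀ (j : J) (x : obj j), map (le_refl j) x = x
  map_map : ∀ {i j k : J} (hij : i ≤ j) (hjk : j ≤ k) (x : obj k),
    map hij (map hjk x) = map (hij.trans hjk) x

attribute [instance] ProjectiveSystem.addGroup ProjectiveSystem.topology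

/-- The projective limit, as a subgroup of the product with the product topology. -/
def ProjectiveSystem.limit {J : Type u} [Preorder J] (S : ProjectiveSystem J) :
    AddSubgroup (∀ j, S.obj j) where
  carrier := {x | ∀ (i j : J) (h : i ≤ j), S.map h (x j) = x i}
  zero_mem' := by
    intro i j h
    simp
  add_mem' := by
    intro x y hx hy i j h
    simp [hx i j h, hy i j h]
  neg_mem' := by
    intro x hx i j h
    simp [hx i j h]

/-- A topological group (written additively) is pro-Lie if it is topologically isomorphic to a
projective limit of finite-dimensional Lie groups. -/
def IsProLie (G : Type u) [AddGroup G] [TopologicalSpace G] : Prop :=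
  ∃ (J : Type u) (_ : Preorder J) (_ : IsDirectedOrder J) (_ : Nonempty J)
    (S : ProjectiveSystem J),
    (∀ j, IsFiniteDimLieGroup (S.obj j)) ∧ Nonempty (G ≃ₜ+ S.limit)

section

open TopologicalSpace Topology Filter Set

/-! Well-order `D` in type ω₁. For each `a`, sending every point outside `Iio a` to `infty` induces
an endomorphism `collapse a` of the free group, whose range `Level a` is countable. These maps embed
the group as a closed subgroup of the product of the discrete groups `Level a`. The embedding is
topological because every neighbourhood of 0 contains some `ker (collapse a)`
(`exists_collapse_eq_zero_imp_mem`). It is closed because coherent families stabilize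
(`exists_toPiLevel_eq`). The product has ℵ₁ ≤ 2^ℵ₀ separable factors, hence is separable, while any
countable subset of the free group is fixed by a single `collapse a` and so is not dense. -/

/-- A product of at most continuum many separable spaces is separable. -/
theorem separableSpace_pi_of_injective {ι : Type*} {X : ι → Type*} [∀ i, TopologicalSpace (X i)]
    [∀ i, SeparableSpace (X i)] [∀ i, Nonempty (X i)] (e : ι → ℕ → Bool)
    (he : Function.Injective e) : SeparableSpace (∀ i, X i) := by
  -- Countably many points suffice: the `i`-th coordinate depends only on the first `n` bits of `e
  -- i`, and there are finitely many such bit strings.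
  let F : (Σ n : ℕ, ((Fin n → Bool) → ℕ)) → ∀ i, X i :=
    fun p i => denseSeq (X i) (p.2 fun k => e i k)
  refine ⟨range F, countable_range F, ?_⟩
  rw [dense_iff_inter_open]
  rintro U hU ⟨x, hx⟩
  obtain ⟨I, u, hu, hIU⟩ := isOpen_pi_iff.mp hU x hx
  obtain ⟨n, hn⟩ : ∃ n : ℕ, Set.InjOn (fun i (k : Fin n) => e i k) (I : Set ι) := by
    have hsep : ∀ p : ι × ι, ∃ m : ℕ, p.1 ≠ p.2 → e p.1 m ≠ e p.2 m := by
      intro p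
      by_cases h : p.1 = p.2
      · exact ⟨0, fun h' => (h' h).elim⟩
      · obtain ⟨m, hm⟩ := Function.ne_iff.mp (he.ne h)
        exact ⟨m, fun _ => hm⟩
    choose m hm using hsep
    refine ⟨(I ×ˢ I).sup m + 1, fun i hi j hj hij => ?_⟩
    by_contra hne
    have hle : m (i, j) ≤ (I ×ˢ I).sup m :=
      Finset.le_sup (Finset.mem_product.mpr ⟨hi, hj⟩)
    exact hm (i, j) hne (congrFun hij ⟨m (i, j), Nat.lt_succ_of_le hle⟩)
  have hdense : ∀ i : I, ∃ k : ℕ, denseSeq (X i) k ∈ u i := fun i =>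
    (denseRange_denseSeq (X i)).exists_mem_open (hu i i.2).1 ⟨x i, (hu i i.2).2⟩
  choose k hk using hdense
  let c : I → Fin n → Bool := fun i l => e i l
  have hc : Function.Injective c := fun i j hij => Subtype.ext (hn i.2 j.2 hij)
  refine ⟨F ⟨n, Function.extend c k 0⟩, hIU fun i hi => ?_, mem_range_self _⟩
  have := hc.extend_apply k 0 ⟨i, hi⟩
  simp only [F]
  change denseSeq (X i) (Function.extend c k 0 (c ⟨i, hi⟩)) ∈ u i
  rw [this]
  exact hk ⟨i, hi⟩

/-! ### Products of discrete groups are prodiscrete and pro-Lie -/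

section Prodiscrete

variable {ι : Type u} (X : ι → Type u) [∀ i, AddCommGroup (X i)] [∀ i, TopologicalSpace (X i)]
  [∀ i, DiscreteTopology (X i)]

theorem nonarchimedeanAddGroup_pi_of_discrete : NonarchimedeanAddGroup (∀ i, X i) where
  is_nonarchimedean U hU := by
    obtain ⟨V, hVU, hV, h0⟩ := mem_nhds_iff.mp hU
    obtain ⟨I, u, hu, hIU⟩ := isOpen_pi_iff.mp hV 0 h0
    refine ⟨⟨AddSubgroup.pi (I : Set ι) fun _ => ⊥, ?_⟩, fun x hx => hVU (hIU fun i hi => ?_)⟩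
    · exact isOpen_set_pi I.finite_toSet fun _ _ => isOpen_discrete _
    · have : x i = 0 := hx i hi
      rw [this]
      exact (hu i hi).2

theorem completeSpace_pi_of_discrete :
    @CompleteSpace (∀ i, X i) (IsTopologicalAddGroup.rightUniformSpace (∀ i, X i)) := by
  let : ∀ i, UniformSpace (X i) := fun i => IsTopologicalAddGroup.rightUniformSpace (X i)
  have : ∀ i, IsUniformAddGroup (X i) := fun i => isUniformAddGroup_of_addCommGroup
  have : ∀ i, CompleteSpace (X i) := fun i => by
    refine ⟨fun {f} hf => ?_⟩
    -- The diagonal is an entourage, so a Cauchy filter contains a singleton.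
    have h0 : {p : X i × X i | p.2 - p.1 = 0} ∈ uniformity (X i) := by
      rw [uniformity_eq_comap_nhds_zero]
      exact preimage_mem_comap ((isOpen_discrete {(0 : X i)}).mem_nhds rfl)
    obtain ⟨t, ht, hts⟩ := (cauchy_iff.mp hf).2 _ h0
    have := hf.1
    obtain ⟨x, hx⟩ := Filter.nonempty_of_mem ht
    refine ⟨x, ?_⟩
    rw [nhds_discrete, le_pure_iff]
    refine Filter.mem_of_superset ht fun y hy => ?_
    exact sub_eq_zero.mp (hts (mk_mem_prod hx hy))
  have h : IsTopologicalAddGroup.rightUniformSpace (∀ i, X i) = Pi.uniformSpace X :=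
    IsUniformAddGroup.rightUniformSpace_eq
  rw [h]
  infer_instance

theorem isProdiscrete_pi_of_discrete : IsProdiscrete (∀ i, X i) where
  t2 := inferInstance
  nonarchimedean := nonarchimedeanAddGroup_pi_of_discrete X
  complete := completeSpace_pi_of_discrete X

theorem isFiniteDimLieGroup_of_discrete (A : Type u) [AddGroup A] [TopologicalSpace A]
    [DiscreteTopology A] : IsFiniteDimLieGroup A := by
  refine ⟨inferInstance, 0, ChartedSpace.ofDiscreteTopology, ?_⟩
  let : ChartedSpace (EuclideanSpace ℝ (Fin 0)) A := ChartedSpace.ofDiscreteTopology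
  have : IsManifold (𝓡 0) ∞ A := IsManifold.of_discreteTopology _
  exact { contMDiff_add := contMDiff_of_discreteTopology
          contMDiff_neg := contMDiff_of_discreteTopology }

/-- The projective system of the finite subproducts of a family of topological groups. -/
def finiteSubproducts : ProjectiveSystem (Finset ι) where
  obj I := ∀ i : I, X i
  map h :=
    { toFun := fun x i => x ⟨i, h i.2⟩
      map_zero' := rfl
      map_add' := fun _ _ => rfl }
  continuous_map _ := continuous_pi fun _ => continuous_apply _
  map_refl _ _ := rfl
  map_map _ _ _ := rfl

/-- A product of topological groups is the projective limit of its finite subproducts. -/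
def piEquivLimitFiniteSubproducts : (∀ i, X i) ≃ₜ+ (finiteSubproducts X).limit where
  toFun x := ⟨fun I i => x i, fun _ _ _ => rfl⟩
  invFun y i := y.1 {i} ⟨i, Finset.mem_singleton_self i⟩
  left_inv _ := rfl
  right_inv y := by
    refine Subtype.ext (funext fun I => funext fun i => ?_)
    exact (congrFun (y.2 {i.1} I (Finset.singleton_subset_iff.mpr i.2)) _).symm
  map_add' _ _ := rfl
  continuous_toFun := Continuous.subtype_mk
    (continuous_pi fun I => continuous_pi fun i => continuous_apply i.1) _
  continuous_invFun := continuous_pi fun i =>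
    (continuous_apply (A := fun j : ({i} : Finset ι) => X j) ⟨i, Finset.mem_singleton_self i⟩).comp
      ((continuous_apply (A := fun I : Finset ι => ∀ j : I, X j) {i}).comp continuous_subtype_val)

theorem isProLie_pi_of_discrete : IsProLie (∀ i, X i) := by
  classical
  refine ⟨Finset ι, inferInstance, inferInstance, inferInstance, finiteSubproducts X, fun I => ?_,
    ⟨piEquivLimitFiniteSubproducts X⟩⟩
  have : DiscreteTopology ((finiteSubproducts X).obj I) :=
    inferInstanceAs (DiscreteTopology (∀ i : I, X i))
  exact isFiniteDimLieGroup_of_discrete _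

end Prodiscrete

/-! ### Order and cardinality of the index set -/

theorem exists_linearOrder_countable_Iio (D : Type u) (hD : Cardinal.mk D = Cardinal.aleph 1) :
    ∃ _ : LinearOrder D, ∀ a : D, (Iio a).Countable := by
  obtain ⟨e⟩ : Nonempty (D ≃ (Cardinal.aleph.{u} 1).ord.ToType) := Cardinal.eq.mp (by simp [hD])
  let o : LinearOrder D := LinearOrder.lift' e e.injective
  refine ⟨o, fun a => ?_⟩
  have hlt : Cardinal.mk (Iio (e a)) < Cardinal.aleph 1 := by
    simpa using Cardinal.mk_Iio_lt (e a)
  have hc : (Iio (e a)).Countable := by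
    rw [← Cardinal.le_aleph0_iff_set_countable]
    exact Order.lt_succ_iff.mp (hlt.trans_eq Cardinal.succ_aleph0.symm)
  exact hc.preimage e.injective

theorem exists_injective_nat_to_bool (D : Type u) (hD : Cardinal.mk D = Cardinal.aleph 1) :
    ∃ e : D → ℕ → Bool, Function.Injective e := by
  have h : Cardinal.lift.{0} (Cardinal.mk D) ≤ Cardinal.lift.{u} (Cardinal.mk (ℕ → Bool)) := by
    rw [hD]
    simpa using Cardinal.aleph_one_le_continuum
  obtain ⟨f⟩ := Cardinal.lift_mk_le'.mp h
  exact ⟨f, f.injective⟩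

/-- Otherwise `D` would be a countable union of the countable sets `Iic d`, `d ∈ s`. -/
theorem exists_forall_lt_of_countable {D : Type u} [LinearOrder D] [Uncountable D]
    (hD : ∀ a : D, (Iio a).Countable) {s : Set D} (hs : s.Countable) : ∃ a, ∀ d ∈ s, d < a := by
  by_contra! h
  refine not_countable (α := D) (countable_univ_iff.mp ?_)
  refine (hs.biUnion fun d _ => (hD d).insert d).mono fun a _ => ?_
  obtain ⟨d, hd, had⟩ := h a
  exact mem_biUnion hd (had.eq_or_lt)

theorem countable_freeAbelianGroup (α : Type*) [Countable α] : Countable (FreeAbelianGroup α) :=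
  (FreeAbelianGroup.equivFinsupp α).injective.countable

/-! ### The free abelian topological group and its collapses -/

namespace FreeAbelianTopGroup

section General

variable {X : Type u}

theorem of_injective : Function.Injective (of : X → FreeAbelianTopGroup X) :=
  FreeAbelianGroup.of_injective

@[elab_as_elim]
theorem induction_on {p : FreeAbelianTopGroup X → Prop} (x : FreeAbelianTopGroup X)
    (zero : p 0) (of : ∀ x, p (of x)) (neg : ∀ x, p x → p (-x))
    (add : ∀ x y, p x → p y → p (x + y)) : p x :=
  FreeAbelianGroup.induction_on x zero of (fun x => neg (.of x)) add

/-- The homomorphism of free abelian groups induced by a self-map of the basis. -/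
def map (f : X → X) : FreeAbelianTopGroup X →+ FreeAbelianTopGroup X :=
  FreeAbelianGroup.map f

@[simp]
theorem map_of (f : X → X) (x : X) : map f (of x) = of (f x) :=
  FreeAbelianGroup.map_of_apply x

variable [TopologicalSpace X]

theorem continuous_of : Continuous (of : X → FreeAbelianTopGroup X) :=
  AddGroupTopology.coinduced_continuous _

/-- The universal property: homomorphisms continuous on the basis are continuous. -/
theorem continuous_of_continuous_comp_of {A : Type*} [AddCommGroup A] [TopologicalSpace A]
    [IsTopologicalAddGroup A] (f : FreeAbelianTopGroup X →+ A)
    (hf : Continuous fun x => f (of x)) : Continuous f := by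
  let t : AddGroupTopology (FreeAbelianTopGroup X) :=
    { toTopologicalSpace := TopologicalSpace.induced f inferInstance
      toIsTopologicalAddGroup := topologicalAddGroup_induced f }
  have h : AddGroupTopology.coinduced (of : X → FreeAbelianTopGroup X) ≤ t := by
    refine sInf_le ?_
    change TopologicalSpace.coinduced _ _ ≤ TopologicalSpace.induced _ _
    rw [← continuous_iff_coinduced_le, continuous_induced_rng]
    exact hf
  exact continuous_iff_le_induced.mpr h

end General

variable {D : Type u} [LinearOrder D]

/-- The retraction of `OnePointLindelofication D` onto `Iio a ∪ {infty}` that sends all other points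
to `infty`. -/
def retract (a : D) : OnePointLindelofication D → OnePointLindelofication D
  | .pt d => if d < a then .pt d else .infty
  | .infty => .infty

theorem retract_pt_of_lt {a d : D} (h : d < a) : retract a (.pt d) = .pt d := if_pos h

theorem retract_pt_of_le {a d : D} (h : a ≤ d) : retract a (.pt d) = .infty := if_neg h.not_gt

theorem retract_retract_of_le {a b : D} (h : a ≤ b) (x : OnePointLindelofication D) :
    retract a (retract b x) = retract a x := by
  rcases x with d | _
  · rcases lt_or_ge d b with hd | hd
    · rw [retract_pt_of_lt hd]
    · rw [retract_pt_of_le hd, retract_pt_of_le (h.trans hd)]; rfl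
  · rfl

theorem retract_retract_of_ge {a b : D} (h : a ≤ b) (x : OnePointLindelofication D) :
    retract b (retract a x) = retract a x := by
  rcases x with d | _
  · rcases lt_or_ge d a with hd | hd
    · rw [retract_pt_of_lt hd, retract_pt_of_lt (hd.trans_le h)]
    · rw [retract_pt_of_le hd]; rfl
  · rfl

/-- The endomorphism of the free abelian group induced by `retract a`. -/
def collapse (a : D) : FreeAbelianTopGroup (OnePointLindelofication D) →+
    FreeAbelianTopGroup (OnePointLindelofication D) :=
  map (retract a)

@[simp]
theorem collapse_of (a : D) (x : OnePointLindelofication D) :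
    collapse a (of x) = of (retract a x) :=
  map_of _ _

theorem collapse_collapse_of_le {a b : D} (h : a ≤ b)
    (x : FreeAbelianTopGroup (OnePointLindelofication D)) :
    collapse a (collapse b x) = collapse a x := by
  induction x using induction_on with
  | zero => simp
  | of x => simp [retract_retract_of_le h]
  | neg x hx => simp [hx]
  | add x y hx hy => simp [hx, hy]

theorem collapse_collapse_of_ge {a b : D} (h : a ≤ b)
    (x : FreeAbelianTopGroup (OnePointLindelofication D)) :
    collapse b (collapse a x) = collapse a x := by
  induction x using induction_on with
  | zero => simp
  | of x => simp [retract_retract_of_ge h]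
  | neg x hx => simp [hx]
  | add x y hx hy => simp [hx, hy]

/-- Along a monotone sequence of indices, the collapses of a fixed element stabilize. -/
theorem exists_forall_ge_collapse_eq {a : ℕ → D} (ha : Monotone a)
    (x : FreeAbelianTopGroup (OnePointLindelofication D)) :
    ∃ n, ∀ m ≥ n, collapse (a m) x = collapse (a n) x := by
  suffices h : ∃ y, ∀ᶠ n in atTop, collapse (a n) x = y by
    obtain ⟨y, hy⟩ := h
    obtain ⟨n, hn⟩ := eventually_atTop.mp hy
    exact ⟨n, fun m hm => (hn m hm).trans (hn n le_rfl).symm⟩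
  induction x using induction_on with
  | zero => exact ⟨0, by simp⟩
  | of x =>
    rcases x with d | _
    · by_cases h : ∃ n, d < a n
      · obtain ⟨n, hn⟩ := h
        refine ⟨of (.pt d), eventually_atTop.mpr ⟨n, fun m hm => ?_⟩⟩
        rw [collapse_of, retract_pt_of_lt (hn.trans_le (ha hm))]
      · push Not at h
        refine ⟨of .infty, Eventually.of_forall fun n => ?_⟩
        rw [collapse_of, retract_pt_of_le (h n)]
    · exact ⟨of .infty, Eventually.of_forall fun n => collapse_of _ _⟩
  | neg x hx =>
    obtain ⟨y, hy⟩ := hx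
    exact ⟨-y, hy.mono fun n hn => by rw [map_neg, hn]⟩
  | add x y hx hy =>
    obtain ⟨x', hx⟩ := hx
    obtain ⟨y', hy⟩ := hy
    exact ⟨x' + y', (hx.and hy).mono fun n hn => by rw [map_add, hn.1, hn.2]⟩

/-- On a basis element the difference is 0 or one of the generators in `hS`. -/
theorem sub_collapse_mem_of_forall {a : D}
    {S : AddSubgroup (FreeAbelianTopGroup (OnePointLindelofication D))}
    (hS : ∀ d, a ≤ d → of (.pt d) - of .infty ∈ S)
    (x : FreeAbelianTopGroup (OnePointLindelofication D)) : x - collapse a x ∈ S := by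
  induction x using induction_on with
  | zero => simp
  | of x =>
    rw [collapse_of]
    rcases x with d | _
    · rcases lt_or_ge d a with hd | hd
      · simp [retract_pt_of_lt hd]
      · rw [retract_pt_of_le hd]
        exact hS d hd
    · simp [retract]
  | neg x hx =>
    have := S.neg_mem hx
    rwa [map_neg, sub_neg_eq_add, neg_add_eq_sub, ← neg_sub]
  | add x y hx hy =>
    rw [map_add, add_sub_add_comm]
    exact S.add_mem hx hy

/-- The range of `collapse a`, given the discrete topology. -/
def Level (a : D) : Type u := (collapse a).range

noncomputable instance (a : D) : AddCommGroup (Level a) :=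
  inferInstanceAs (AddCommGroup (collapse a).range)

instance (a : D) : TopologicalSpace (Level a) := ⊥

instance (a : D) : DiscreteTopology (Level a) := ⟨rfl⟩

theorem Level.collapse_val_of_le {a b : D} (h : a ≤ b) (y : Level a) :
    collapse b y.1 = y.1 := by
  obtain ⟨_, x, rfl⟩ := y
  exact collapse_collapse_of_ge h x

/-- `collapse a` as a homomorphism onto the discrete group `Level a`. -/
noncomputable def toLevel (a : D) : FreeAbelianTopGroup (OnePointLindelofication D) →+ Level a :=
  (collapse a).rangeRestrict

theorem toLevel_val (a : D) (x : FreeAbelianTopGroup (OnePointLindelofication D)) :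
    (toLevel a x).1 = collapse a x := rfl

theorem Level.countable {a : D} (ha : (Iio a).Countable) : Countable (Level a) := by
  have := ha.to_subtype
  have := countable_freeAbelianGroup (Option (Iio a))
  let j : FreeAbelianGroup (Option (Iio a)) →+
      FreeAbelianTopGroup (OnePointLindelofication D) :=
    FreeAbelianGroup.lift fun o => of (o.elim .infty fun d => .pt d.1)
  have hj : (collapse a).range ≤ j.range := by
    rintro _ ⟨x, rfl⟩
    induction x using induction_on with
    | zero => rw [map_zero]; exact zero_mem _
    | of x =>
      have hinf : of .infty ∈ j.range :=
        ⟨FreeAbelianGroup.of none, FreeAbelianGroup.lift_apply_of _ _⟩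
      rw [collapse_of]
      rcases x with d | _
      · rcases lt_or_ge d a with hd | hd
        · rw [retract_pt_of_lt hd]
          exact ⟨FreeAbelianGroup.of (some ⟨d, hd⟩), FreeAbelianGroup.lift_apply_of _ _⟩
        · rwa [retract_pt_of_le hd]
      · exact hinf
    | neg x hx => rw [map_neg]; exact neg_mem hx
    | add x y hx hy => rw [map_add]; exact add_mem hx hy
  exact ((countable_range j).mono hj).to_subtype

/-- On the basis the map takes the same value at `infty` and at every point outside the countable
set `Iio a`. -/
theorem continuous_toLevel {a : D} (ha : (Iio a).Countable) : Continuous (toLevel a) := by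
  refine continuous_of_continuous_comp_of _ ⟨fun U _ hU => ha.mono fun d hd => ?_⟩
  by_contra hda
  refine hd ?_
  have h : toLevel a (of (.pt d)) = toLevel a (of .infty) := by
    refine Subtype.ext ?_
    rw [toLevel_val, toLevel_val, collapse_of, collapse_of, retract_pt_of_le (not_lt.mp hda)]
    rfl
  change toLevel a (of (.pt d)) ∈ U
  rw [h]
  exact hU

variable [Uncountable D]

/-- Every neighbourhood of zero contains the kernel of some `collapse a`. -/
theorem exists_collapse_eq_zero_imp_mem (hD : ∀ a : D, (Iio a).Countable)
    {U : Set (FreeAbelianTopGroup (OnePointLindelofication D))} (hU : U ∈ 𝓝 0) :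
    ∃ a : D, ∀ x, collapse a x = 0 → x ∈ U := by
  let P := {V : Set (FreeAbelianTopGroup (OnePointLindelofication D)) // V ∈ 𝓝 0}
  have hstep : ∀ V : P, ∃ W : P, ∀ x ∈ W.1, ∀ y ∈ W.1, x - y ∈ V.1 := fun V => by
    have ht : Tendsto (fun p : FreeAbelianTopGroup (OnePointLindelofication D) × _ => p.1 - p.2)
        (𝓝 (0, 0)) (𝓝 0) := by
      simpa using (continuous_sub (G := FreeAbelianTopGroup (OnePointLindelofication D))).tendsto
        (0, 0)
    have := ht V.2
    rw [nhds_prod_eq] at this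
    obtain ⟨W, hW, hWV⟩ := mem_prod_same_iff.mp this
    exact ⟨⟨W, hW⟩, fun x hx y hy => hWV (mk_mem_prod hx hy)⟩
  choose next hnext using hstep
  let V : ℕ → P := fun n => next^[n] ⟨U, hU⟩
  have hV : ∀ n, ∀ x ∈ (V (n + 1)).1, ∀ y ∈ (V (n + 1)).1, x - y ∈ (V n).1 := fun n => by
    have : V (n + 1) = next (V n) := Function.iterate_succ_apply' _ _ _
    rw [this]
    exact hnext _
  -- Since V (n+1) - V (n+1) ⊆ V n, the intersection of the sequence is a subgroup inside `U`,
  -- though not obviously open.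
  let S : AddSubgroup (FreeAbelianTopGroup (OnePointLindelofication D)) :=
    AddSubgroup.ofSub (⋂ n, (V n).1) ⟨0, mem_iInter.mpr fun n => mem_of_mem_nhds (V n).2⟩
      fun {x} hx {y} hy => mem_iInter.mpr fun n => by
        simpa [sub_eq_add_neg] using
          hV n x (mem_iInter.mp hx (n + 1)) y (mem_iInter.mp hy (n + 1))
  have hcount : ∀ n, {d : D | of (.pt d) - of .infty ∉ (V n).1}.Countable := fun n => by
    obtain ⟨W, hWV, hW, h0⟩ := mem_nhds_iff.mp (V n).2
    have hcont : Continuous fun x : OnePointLindelofication D => of x - of .infty :=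
      continuous_of.sub continuous_const
    refine (hW.preimage hcont ?_).mono fun d hd hdW => hd (hWV hdW)
    simpa using h0
  -- Each `V n` misses only countably many generators; `a` lies above all the exceptions at once.
  obtain ⟨a, ha⟩ := exists_forall_lt_of_countable hD (countable_iUnion hcount)
  refine ⟨a, fun x hx => ?_⟩
  have hxS : x - collapse a x ∈ S := sub_collapse_mem_of_forall (fun d hd => ?_) x
  · rw [hx, sub_zero] at hxS
    exact mem_iInter.mp hxS 0
  · refine mem_iInter.mpr fun n => ?_
    by_contra hdn
    exact (ha d (mem_iUnion.mpr ⟨n, hdn⟩)).not_ge hd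

/-- Countably many elements are simultaneously fixed by some `collapse a`. -/
theorem exists_forall_mem_collapse_eq (hD : ∀ a : D, (Iio a).Countable)
    {s : Set (FreeAbelianTopGroup (OnePointLindelofication D))} (hs : s.Countable) :
    ∃ a : D, ∀ x ∈ s, collapse a x = x := by
  have hsingle : ∀ x : FreeAbelianTopGroup (OnePointLindelofication D),
      ∃ a : D, ∀ b ≥ a, collapse b x = x := fun x => by
    inhabit D
    induction x using induction_on with
    | zero => exact ⟨default, by simp⟩
    | of x =>
      rcases x with d | _
      · obtain ⟨a, ha⟩ := exists_forall_lt_of_countable hD (countable_singleton d)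
        refine ⟨a, fun b hb => ?_⟩
        rw [collapse_of, retract_pt_of_lt ((ha d rfl).trans_le hb)]
      · exact ⟨default, fun b _ => collapse_of _ _⟩
    | neg x hx =>
      obtain ⟨a, ha⟩ := hx
      exact ⟨a, fun b hb => by rw [map_neg, ha b hb]⟩
    | add x y hx hy =>
      obtain ⟨a, ha⟩ := hx
      obtain ⟨c, hc⟩ := hy
      refine ⟨max a c, fun b hb => ?_⟩
      rw [map_add, ha b ((le_max_left _ _).trans hb), hc b ((le_max_right _ _).trans hb)]
  choose f hf using hsingle
  obtain ⟨a, ha⟩ := exists_forall_lt_of_countable hD (hs.image f)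
  exact ⟨a, fun x hx => hf x a (ha _ (mem_image_of_mem f hx)).le⟩

/-! ### The closed embedding and non-separability -/

/-- The canonical homomorphism to the product of the discrete groups `Level a`. -/
noncomputable def toPiLevel : FreeAbelianTopGroup (OnePointLindelofication D) →+ ∀ a : D, Level a :=
  AddMonoidHom.pi toLevel

theorem toPiLevel_injective (hD : ∀ a : D, (Iio a).Countable) :
    Function.Injective (toPiLevel (D := D)) := by
  refine (injective_iff_map_eq_zero _).mpr fun x hx => ?_
  obtain ⟨a, ha⟩ := exists_forall_mem_collapse_eq hD (countable_singleton x)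
  rw [← ha x rfl]
  exact congrArg Subtype.val (congrFun hx a)

theorem isInducing_toPiLevel (hD : ∀ a : D, (Iio a).Countable) :
    IsInducing (toPiLevel (D := D)) := by
  refine IsTopologicalAddGroup.isInducing_iff_nhds_zero.mpr (le_antisymm ?_ fun U hU => ?_)
  · have hc : Continuous (toPiLevel (D := D)) := continuous_pi fun a => continuous_toLevel (hD a)
    simpa using (hc.tendsto 0).le_comap
  · obtain ⟨a, ha⟩ := exists_collapse_eq_zero_imp_mem hD hU
    refine ⟨{y | y a = 0}, ?_, fun x hx => ha x (congrArg Subtype.val hx)⟩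
    exact ((isOpen_discrete {(0 : Level a)}).preimage (continuous_apply a)).mem_nhds rfl

/-- A coherent family in the product of the groups `Level a` comes from a single element. -/
theorem exists_toPiLevel_eq (hD : ∀ a : D, (Iio a).Countable) (y : ∀ a : D, Level a)
    (hy : ∀ a b, a ≤ b → collapse a (y b).1 = (y a).1) : ∃ x, toPiLevel x = y := by
  obtain ⟨a, ha⟩ : ∃ a, ∀ b ≥ a, (y b).1 = (y a).1 := by
    -- If the family never stabilized, it would change at each step of an increasing sequence. A
    -- bound `s` of that sequence gives one element `y s` whose collapses change infinitely often,
    -- which is impossible.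
    by_contra! h
    choose next hle hne using h
    inhabit D
    let c : ℕ → D := fun n => next^[n] default
    have hc : ∀ n, c (n + 1) = next (c n) := fun n => Function.iterate_succ_apply' _ _ _
    have hmono : Monotone c := monotone_nat_of_le_succ fun n => (hc n).symm ▸ hle (c n)
    obtain ⟨s, hs⟩ := exists_forall_lt_of_countable hD (countable_range c)
    obtain ⟨n, hn⟩ := exists_forall_ge_collapse_eq hmono (y s).1
    have hcs : ∀ n, collapse (c n) (y s).1 = (y (c n)).1 :=
      fun n => hy _ _ (hs _ (mem_range_self n)).le
    have := hn (n + 1) n.le_succ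
    rw [hcs, hcs, hc] at this
    exact hne (c n) this
  refine ⟨(y a).1, funext fun b => Subtype.ext ?_⟩
  change collapse b (y a).1 = (y b).1
  rcases le_total a b with hab | hab
  · rw [Level.collapse_val_of_le hab, ha b hab]
  · exact hy b a hab

theorem isClosed_range_toPiLevel (hD : ∀ a : D, (Iio a).Countable) :
    IsClosed (range (toPiLevel (D := D))) := by
  have h : range (toPiLevel (D := D)) =
      ⋂ (a : D) (b : D) (_ : a ≤ b), {y | collapse a (y b).1 = (y a).1} := by
    ext y
    simp only [mem_iInter]
    refine ⟨?_, fun hy => exists_toPiLevel_eq hD y hy⟩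
    rintro ⟨x, rfl⟩ a b hab
    exact collapse_collapse_of_le hab x
  rw [h]
  refine isClosed_iInter fun a => isClosed_iInter fun b => isClosed_iInter fun _ => ?_
  exact (isClosed_discrete {p : Level a × Level b | collapse a p.2.1 = p.1.1}).preimage
    ((continuous_apply a).prodMk (continuous_apply b))

/-- If `collapse a` fixes a countable set and `a < b`, no member agrees with `of (.pt a)` under
`collapse b`: applying `collapse a` would force it to be `of .infty`. -/
theorem not_separableSpace (hD : ∀ a : D, (Iio a).Countable) :
    ¬ SeparableSpace (FreeAbelianTopGroup (OnePointLindelofication D)) := by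
  rintro ⟨s, hs, hdense⟩
  obtain ⟨a, ha⟩ := exists_forall_mem_collapse_eq hD hs
  obtain ⟨b, hb⟩ := exists_forall_lt_of_countable hD (countable_singleton a)
  have hab : a < b := hb a rfl
  have hopen : IsOpen (toLevel b ⁻¹' {toLevel b (of (.pt a))}) :=
    (isOpen_discrete _).preimage (continuous_toLevel (hD b))
  obtain ⟨x, hxs, hx⟩ := hdense.exists_mem_open hopen ⟨_, rfl⟩
  have hx' : collapse b x = collapse b (of (.pt a)) := congrArg Subtype.val hx
  have h := congrArg (collapse a) hx'
  rw [collapse_collapse_of_le hab.le, collapse_collapse_of_le hab.le, ha x hxs, collapse_of,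
    retract_pt_of_le le_rfl] at h
  rw [h, collapse_of, collapse_of, retract_pt_of_lt hab] at hx'
  exact OnePointLindelofication.noConfusion rfl (heq_of_eq (of_injective hx'))

end FreeAbelianTopGroup

end

open FreeAbelianTopGroup

theorem mainTheorem9 (D : Type u) (hD : Cardinal.mk D = Cardinal.aleph 1) :
    ∃ (G : Type u) (_ : AddCommGroup G) (_ : TopologicalSpace G) (_ : IsTopologicalAddGroup G),
      TopologicalSpace.SeparableSpace G ∧ IsProdiscrete G ∧ IsProLie G ∧
        ∃ K : AddSubgroup G,
          IsClosed (K : Set G) ∧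
          ¬ TopologicalSpace.SeparableSpace K ∧
          Nonempty (FreeAbelianTopGroup (OnePointLindelofication D) ≃ₜ+ K) := by
  obtain ⟨_, hcount⟩ := exists_linearOrder_countable_Iio D hD
  obtain ⟨e, he⟩ := exists_injective_nat_to_bool D hD
  have : Uncountable D := by
    rw [← Cardinal.aleph0_lt_mk_iff, hD]
    exact Cardinal.aleph0_lt_aleph_one
  have : ∀ a : D, Countable (Level a) := fun a => Level.countable (hcount a)
  let E : FreeAbelianTopGroup (OnePointLindelofication D) ≃ₜ+ (toPiLevel (D := D)).range :=
    { AddMonoidHom.ofInjective (toPiLevel_injective hcount) with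
      continuous_toFun := (isInducing_toPiLevel hcount).continuous.subtype_mk _
      continuous_invFun := by
        rw [(isInducing_toPiLevel hcount).continuous_iff]
        refine continuous_subtype_val.congr fun y => ?_
        exact congrArg Subtype.val
          ((AddMonoidHom.ofInjective (toPiLevel_injective hcount)).apply_symm_apply y).symm }
  refine ⟨∀ a : D, Level a, inferInstance, inferInstance, inferInstance,
    separableSpace_pi_of_injective e he, isProdiscrete_pi_of_discrete _,
    isProLie_pi_of_discrete _, toPiLevel.range, ?_, fun _ => ?_, ⟨E⟩⟩
  · exact isClosed_range_toPiLevel hcount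
  · exact not_separableSpace hcount
      (E.symm.surjective.denseRange.separableSpace E.symm.continuous)
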